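/- Let $G=(V,E)$ be a finite simple undirected graph that is a \emph{proper interval graph}, that is, there are closed real intervals $(I_v)_{v\in V}$ such that distinct vertices $u,v$ are adjacent if and only if $I_u\cap I_v\neq\emptyset$, and no interval of the family contains another one. A \emph{clique transversal} of $G$ is a set of vertices that intersects every inclusion-wise maximal clique of $G$, and the \emph{upper clique transversal number} of $G$ is the maximum size of an inclusion-wise minimal clique transversal of $G$ (read as $0$ if $V=\emptyset$). Let $B_G$ be the \emph{vertex-clique incidence graph} of $G$: the bipartite graph whose two parts are $V$ and the set of maximal cliques of $G$, in which $x\in V$ and a maximal clique $C$ are adjacent if and only if $x\in C$. The \emph{induced matching number} of a graph $H$ is the maximum size of a set $M$ of pairwise disjoint edges of $H$ such that the only edges of $H$ having both endpoints among the endpoints of edges in $M$ are those of $M$. Then the upper clique transversal number of $G$ is equal to the induced matching number of $B_G$. -/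

import Mathlib

namespace UpperCliqueTransversal

universe u

/-- `G` is a proper interval graph: there are closed real intervals `[l v, r v]`, one for each
vertex, such that distinct vertices are adjacent iff their intervals intersect, and no interval
contains the interval of another vertex. -/
def IsProperIntervalGraph {V : Type u} (G : SimpleGraph V) : Prop :=
  ∃ l r : V → ℝ,
    (∀ v, l v ≤ r v) ∧
    (∀ u v, u ≠ v → (G.Adj u v ↔ (Set.Icc (l u) (r u) ∩ Set.Icc (l v) (r v)).Nonempty)) ∧
    (∀ u v, u ≠ v → ¬ Set.Icc (l u) (r u) ⊆ Set.Icc (l v) (r v))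

/-- The set of (inclusion-wise) maximal cliques of `G`. -/
def maximalCliques {V : Type u} (G : SimpleGraph V) : Set (Set V) :=
  {C | Maximal G.IsClique C}

/-- A clique transversal: a set of vertices that intersects all maximal cliques. -/
def IsCliqueTransversal {V : Type u} (G : SimpleGraph V) (S : Set V) : Prop :=
  ∀ C ∈ maximalCliques G, (C ∩ S).Nonempty

/-- The maximum size of an (inclusion-wise) minimal clique transversal. -/
noncomputable def upperCliqueTransversalNumber {V : Type u} (G : SimpleGraph V) : ℕ :=
  sSup {n | ∃ S : Set V, Minimal (IsCliqueTransversal G) S ∧ S.ncard = n}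

/-- The vertex-clique incidence graph `B_G`: the bipartite graph with parts the vertices and the
maximal cliques of `G`, in which a vertex `x` and a maximal clique `C` are adjacent iff `x ∈ C`. -/
def vertexCliqueIncidenceGraph {V : Type u} (G : SimpleGraph V) :
    SimpleGraph (V ⊕ maximalCliques G) where
  Adj
    | Sum.inl x, Sum.inr C => x ∈ C.1
    | Sum.inr C, Sum.inl x => x ∈ C.1
    | _, _ => False
  symm := ⟨by rintro (x | C) (y | D) h <;> exact h⟩
  loopless := ⟨by rintro (x | C) h <;> exact h⟩

/-- An induced matching: a set of pairwise disjoint edges such that every edge of the graph whose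
endpoints are all endpoints of edges in the set belongs to the set. -/
def IsInducedMatching {W : Type u} (H : SimpleGraph W) (M : Set (Sym2 W)) : Prop :=
  M ⊆ H.edgeSet ∧
  (∀ e ∈ M, ∀ f ∈ M, e ≠ f → ∀ w, w ∈ e → w ∉ f) ∧
  (∀ e ∈ H.edgeSet, (∀ w ∈ e, ∃ f ∈ M, w ∈ f) → e ∈ M)

/-- The maximum size of an induced matching. -/
noncomputable def inducedMatchingNumber {W : Type u} (H : SimpleGraph W) : ℕ :=
  sSup {n | ∃ M : Set (Sym2 W), IsInducedMatching H M ∧ M.ncard = n}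

/-- In a finite graph with at least one vertex, the upper clique transversal number is attained,
i.e. it is a maximum. -/
theorem isGreatest_upperCliqueTransversalNumber {V : Type u} [Finite V] [Nonempty V]
    (G : SimpleGraph V) :
    IsGreatest {n | ∃ S : Set V, Minimal (IsCliqueTransversal G) S ∧ S.ncard = n}
      (upperCliqueTransversalNumber G) := by
  have hb : BddAbove {n | ∃ S : Set V, Minimal (IsCliqueTransversal G) S ∧ S.ncard = n} := by
    refine ⟨Nat.card V, ?_⟩
    rintro n ⟨S, -, rfl⟩
    exact Set.ncard_le_card S
  have huniv : IsCliqueTransversal G Set.univ := by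
    intro C hC
    rw [Set.inter_univ]
    by_contra hne
    rw [Set.not_nonempty_iff_eq_empty] at hne
    obtain ⟨v⟩ := ‹Nonempty V›
    have h1 : G.IsClique {v} := Set.pairwise_singleton _ _
    have h2 := hC.2 h1 (by simp [hne]) (Set.mem_singleton v)
    simp [hne] at h2
  obtain ⟨S, -, hS⟩ := (Set.toFinite {S | IsCliqueTransversal G S}).exists_le_minimal huniv
  exact ⟨Nat.sSup_mem ⟨S.ncard, S, hS, rfl⟩ hb, fun n hn => le_csSup hb hn⟩

/-- In a finite graph, the induced matching number is attained, i.e. it is a maximum. -/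
theorem isGreatest_inducedMatchingNumber {W : Type u} [Finite W] (H : SimpleGraph W) :
    IsGreatest {n | ∃ M : Set (Sym2 W), IsInducedMatching H M ∧ M.ncard = n}
      (inducedMatchingNumber H) := by
  have hb : BddAbove {n | ∃ M : Set (Sym2 W), IsInducedMatching H M ∧ M.ncard = n} := by
    refine ⟨Nat.card (Sym2 W), ?_⟩
    rintro n ⟨M, -, rfl⟩
    exact Set.ncard_le_card M
  have h0 : IsInducedMatching H ∅ := by
    refine ⟨Set.empty_subset _, by simp, ?_⟩
    intro e _ h
    induction e with
    | h x y => simpa using h x (by simp)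
  exact ⟨Nat.sSup_mem ⟨_, ∅, h0, rfl⟩ hb, fun n hn => le_csSup hb hn⟩

end UpperCliqueTransversal

namespace UpperCliqueTransversal

variable {V : Type*} {G : SimpleGraph V}

/-! Induced matchings of `B_G` amount to irredundant sets: match each vertex with a maximal clique
in which it is the only element of the set. Minimal clique transversals are exactly the irredundant
transversals, which gives `≤`. For `≥`, order the vertices by left endpoint, so that maximal cliques
are convex. An irredundant set missing a maximal clique can then be enlarged or pushed right
(`IsIrredundant.exists_improvement`), so an extremal one is a transversal of at least the same size.
-/

/-- A set of vertices is irredundant if each of its elements is the only one lying in some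
maximal clique. -/
def IsIrredundant (G : SimpleGraph V) (S : Set V) : Prop :=
  ∀ v ∈ S, ∃ C ∈ maximalCliques G, C ∩ S = {v}

theorem Minimal.isIrredundant {S : Set V} (hS : Minimal (IsCliqueTransversal G) S) :
    IsIrredundant G S := by
  intro v hv
  have h : ¬ IsCliqueTransversal G (S \ {v}) := fun h =>
    (hS.2 h Set.sdiff_subset hv).2 rfl
  unfold IsCliqueTransversal at h
  push Not at h
  obtain ⟨C, hC, hCS⟩ := h
  refine ⟨C, hC, Set.Subset.antisymm ?_ ?_⟩
  · rintro w ⟨hwC, hwS⟩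
    by_contra hwv
    exact (Set.eq_empty_iff_forall_notMem.1 hCS) w ⟨hwC, hwS, hwv⟩
  · obtain ⟨w, hwC, hwS⟩ := hS.1 C hC
    have hwv : w = v := by
      by_contra hwv
      exact (Set.eq_empty_iff_forall_notMem.1 hCS) w ⟨hwC, hwS, hwv⟩
    rintro _ rfl
    exact ⟨hwv ▸ hwC, hv⟩

theorem IsIrredundant.minimal {S : Set V} (hS : IsIrredundant G S)
    (hT : IsCliqueTransversal G S) : Minimal (IsCliqueTransversal G) S := by
  refine ⟨hT, fun T hT' hTS v hv => ?_⟩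
  obtain ⟨C, hC, hCS⟩ := hS v hv
  obtain ⟨w, hwC, hwT⟩ := hT' C hC
  have hw : w ∈ C ∩ S := ⟨hwC, hTS hwT⟩
  rw [hCS] at hw
  exact hw ▸ hwT

theorem IsIrredundant.exists_isInducedMatching {S : Set V} (hS : IsIrredundant G S) :
    ∃ M, IsInducedMatching (vertexCliqueIncidenceGraph G) M ∧ M.ncard = S.ncard := by
  choose! C hC hCS using hS
  have key : ∀ v ∈ S, ∀ w ∈ S, w ∈ C v → w = v := fun v hv w hw h => by
    have : w ∈ C v ∩ S := ⟨h, hw⟩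
    rwa [hCS v hv] at this
  have hmem : ∀ v ∈ S, v ∈ C v := fun v hv => by
    have : v ∈ C v ∩ S := by rw [hCS v hv]; rfl
    exact this.1
  let f : S → Sym2 (V ⊕ maximalCliques G) := fun v =>
    s(Sum.inl v.1, Sum.inr ⟨C v, hC v v.2⟩)
  have hf : Function.Injective f := by
    intro v w h
    simp only [f, Sym2.eq_iff] at h
    rcases h with ⟨h, -⟩ | ⟨h, -⟩
    · exact Subtype.ext (Sum.inl_injective h)
    · cases h
  refine ⟨Set.range f, ⟨?_, ?_, ?_⟩, ?_⟩
  · rintro _ ⟨v, rfl⟩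
    exact hmem v v.2
  · rintro _ ⟨v, rfl⟩ _ ⟨w, rfl⟩ hne x hx hx'
    have hvw : v ≠ w := fun h => hne (h ▸ rfl)
    simp only [f, Sym2.mem_iff] at hx hx'
    rcases hx with rfl | rfl <;> rcases hx' with h | h
    · exact hvw (Subtype.ext (Sum.inl_injective h))
    · cases h
    · cases h
    · have h : C v = C w := congrArg Subtype.val (Sum.inr_injective h)
      exact hvw (Subtype.ext (key w w.2 v v.2 (h ▸ hmem v v.2)))
  · have main : ∀ (x : V) (D : maximalCliques G), x ∈ D.1 →
        (∃ e ∈ Set.range f, Sum.inl x ∈ e) → (∃ e ∈ Set.range f, Sum.inr D ∈ e) →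
        s(Sum.inl x, Sum.inr D) ∈ Set.range f := by
      rintro x D hxD ⟨_, ⟨v, rfl⟩, hv⟩ ⟨_, ⟨w, rfl⟩, hw⟩
      simp only [f, Sym2.mem_iff, Sum.inl.injEq, Sum.inr.injEq, reduceCtorEq, or_false,
        false_or] at hv hw
      subst hv hw
      exact ⟨v, by rw [Subtype.ext (key w w.2 v v.2 hxD)]⟩
    intro e he h
    induction e with
    | h a b =>
      have ha := h a (by simp)
      have hb := h b (by simp)
      rcases a with x | D <;> rcases b with y | E
      · exact he.elim
      · exact main x E he ha hb
      · rw [Sym2.eq_swap]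
        exact main y D he hb ha
      · exact he.elim
  · rw [← Set.image_univ, Set.ncard_image_of_injective _ hf, Set.ncard_univ, Nat.card_coe_set_eq]

theorem IsInducedMatching.exists_isIrredundant [Finite V]
    {M : Set (Sym2 (V ⊕ maximalCliques G))}
    (hM : IsInducedMatching (vertexCliqueIncidenceGraph G) M) :
    ∃ S, IsIrredundant G S ∧ M.ncard ≤ S.ncard := by
  obtain ⟨hE, hdisj, hind⟩ := hM
  let S : Set V := {v | ∃ C, s(Sum.inl v, Sum.inr C) ∈ M}
  have hex : ∀ v ∈ S, ∃ e ∈ M, Sum.inl v ∈ e := fun v ⟨C, h⟩ => ⟨_, h, by simp⟩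
  have hsub : ∀ v, ∃ e, v ∈ S → e ∈ M ∧ Sum.inl v ∈ e := fun v => by
    by_cases hv : v ∈ S
    · obtain ⟨e, he⟩ := hex v hv
      exact ⟨e, fun _ => he⟩
    -- Arbitrary value: `f` is only used on `S`.
    · exact ⟨s(Sum.inl v, Sum.inl v), fun h => (hv h).elim⟩
  choose f hf using hsub
  refine ⟨S, ?_, ?_⟩
  · rintro v ⟨C, hvC⟩
    refine ⟨C, C.2, Set.Subset.antisymm ?_ ?_⟩
    · rintro w ⟨hwC, hwS⟩
      have hw : s(Sum.inl w, Sum.inr C) ∈ M := by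
        refine hind _ hwC fun a ha => ?_
        rcases Sym2.mem_iff.1 ha with rfl | rfl
        · exact hex w hwS
        · exact ⟨_, hvC, by simp⟩
      by_contra hwv
      refine hdisj _ hw _ hvC (fun h => hwv ?_) (Sum.inr C) (by simp) (by simp)
      simpa using h
    · rintro _ rfl
      exact ⟨hE hvC, C, hvC⟩
  · have hMS : M ⊆ f '' S := by
      have main : ∀ x C, s(Sum.inl x, Sum.inr C) ∈ M → s(Sum.inl x, Sum.inr C) ∈ f '' S := by
        intro x C h
        have hx : x ∈ S := ⟨C, h⟩
        refine ⟨x, hx, ?_⟩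
        by_contra hne
        exact hdisj _ (hf x hx).1 _ h hne (Sum.inl x) (hf x hx).2 (by simp)
      intro e he
      have hee := hE he
      induction e with
      | h a b =>
        rcases a with x | D <;> rcases b with y | E
        · exact hee.elim
        · exact main x E he
        · rw [Sym2.eq_swap] at he ⊢
          exact main y D he
        · exact hee.elim
    exact (Set.ncard_le_ncard hMS).trans (Set.ncard_image_le)

/-- In a proper interval graph, the vertices can be placed on a line such that all maximal
cliques are convex. -/
theorem IsProperIntervalGraph.exists_convex_placement (hG : IsProperIntervalGraph G) :
    ∃ l : V → ℝ, ∀ C ∈ maximalCliques G, ∀ u ∈ C, ∀ v ∈ C, ∀ w,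
      l u ≤ l w → l w ≤ l v → w ∈ C := by
  obtain ⟨l, r, hlr, hadj, hprop⟩ := hG
  -- Without containments, left and right endpoints are ordered alike.
  have hmono : ∀ u v, l u ≤ l v → r u ≤ r v := by
    intro u v h
    by_contra! hr
    exact hprop v u (by rintro rfl; exact lt_irrefl _ hr) (Set.Icc_subset_Icc h hr.le)
  refine ⟨l, ?_⟩
  intro C hC u hu v hv w huw hwv
  have hle : ∀ a ∈ C, ∀ b ∈ C, l a ≤ r b := by
    intro a ha b hb
    rcases eq_or_ne a b with rfl | hab
    · exact hlr a
    · obtain ⟨x, hx, hx'⟩ := (hadj a b hab).1 (hC.1 ha hb hab)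
      exact hx.1.trans hx'.2
  have hclique : G.IsClique (insert w C) := by
    refine SimpleGraph.isClique_insert.2 ⟨hC.1, fun c hc hwc => (hadj w c hwc).2 ?_⟩
    rw [Set.Icc_inter_Icc, Set.nonempty_Icc]
    exact sup_le (le_inf (hlr w) (hwv.trans (hle v hv c hc)))
      (le_inf ((hle c hc u hu).trans (hmono u w huw)) (hlr c))
  exact hC.2 hclique (Set.subset_insert w C) (Set.mem_insert w C)

theorem nonempty_of_mem_maximalCliques [Nonempty V] {C : Set V} (hC : C ∈ maximalCliques G) :
    C.Nonempty := by
  by_contra hne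
  rw [Set.not_nonempty_iff_eq_empty] at hne
  obtain ⟨v⟩ := ‹Nonempty V›
  have h : v ∈ C := hC.2 (SimpleGraph.isClique_singleton v) (by simp [hne]) rfl
  simp [hne] at h

/-- An irredundant set missing a maximal clique can be pushed to the right: one can add an element,
or replace an element by a larger one. -/
theorem IsIrredundant.exists_improvement [Finite V] [Nonempty V] {l : V → ℝ}
    (hconv : ∀ C ∈ maximalCliques G, ∀ u ∈ C, ∀ v ∈ C, ∀ w, l u ≤ l w → l w ≤ l v → w ∈ C)
    {S : Set V} (hS : IsIrredundant G S) (hT : ¬ IsCliqueTransversal G S) :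
    ∃ x ∉ S, IsIrredundant G (insert x S) ∨
      ∃ v ∈ S, l v < l x ∧ IsIrredundant G (insert x (S \ {v})) := by
  unfold IsCliqueTransversal at hT
  push Not at hT
  obtain ⟨Q, hQ, hQS⟩ := hT
  have hQS : ∀ q ∈ Q, q ∉ S := fun q hq hqS =>
    (Set.eq_empty_iff_forall_notMem.1 hQS) q ⟨hq, hqS⟩
  obtain ⟨x, hxQ, hx⟩ := Set.exists_min_image Q l (Set.toFinite Q)
    (nonempty_of_mem_maximalCliques hQ)
  have hxS := hQS x hxQ
  choose! C hC hCS using hS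
  have key : ∀ v ∈ S, ∀ w, w ∈ C v → w ∈ S → w = v := fun v hv w h hw => by
    have : w ∈ C v ∩ S := ⟨h, hw⟩
    rwa [hCS v hv] at this
  have hmem : ∀ v ∈ S, v ∈ C v := fun v hv => by
    have : v ∈ C v ∩ S := by rw [hCS v hv]; rfl
    exact this.1
  -- Otherwise `v` lies to the right of all of `Q`, since convexity would put it in `Q` if not; then
  -- `Q ⊆ C v` contradicts the maximality of `Q`.
  have hlt : ∀ v ∈ S, x ∈ C v → l v < l x := by
    intro v hv hxC
    by_contra! hxv
    have hsub : Q ⊆ C v := by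
      intro q hq
      refine hconv _ (hC v hv) x hxC v (hmem v hv) q (hx q hq) ?_
      by_contra! hvq
      exact hQS v (hconv Q hQ x hxQ q hq v hxv hvq.le) hv
    exact hQS v (hQ.2 (hC v hv).1 hsub (hmem v hv)) hv
  refine ⟨x, hxS, ?_⟩
  by_cases h : ∃ v ∈ S, x ∈ C v
  · obtain ⟨v, hv, hxv⟩ := h
    -- Both `v` and `w` are left of `x`, so the one nearer to `x` lies in the private clique of the
    -- other.
    have huniq : ∀ w ∈ S, x ∈ C w → w = v := by
      intro w hw hxw
      rcases le_total (l v) (l w) with h | h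
      · exact key v hv w (hconv _ (hC v hv) v (hmem v hv) x hxv w h (hlt w hw hxw).le) hw
      · exact (key w hw v (hconv _ (hC w hw) w (hmem w hw) x hxw v h (hlt v hv hxv).le) hv).symm
    refine Or.inr ⟨v, hv, hlt v hv hxv, ?_⟩
    rintro w (rfl | ⟨hw, hwv⟩)
    · refine ⟨C v, hC v hv, Set.Subset.antisymm ?_ ?_⟩
      · rintro y ⟨hyC, rfl | ⟨hyS, hyv⟩⟩
        · rfl
        · exact (hyv (key v hv y hyC hyS)).elim
      · rintro _ rfl
        exact ⟨hxv, Set.mem_insert _ _⟩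
    · refine ⟨C w, hC w hw, Set.Subset.antisymm ?_ ?_⟩
      · rintro y ⟨hyC, rfl | ⟨hyS, hyv⟩⟩
        · exact (hwv (huniq w hw hyC)).elim
        · exact key w hw y hyC hyS
      · rintro _ rfl
        exact ⟨hmem _ hw, Or.inr ⟨hw, hwv⟩⟩
  · push Not at h
    refine Or.inl ?_
    rintro w (rfl | hw)
    · refine ⟨Q, hQ, Set.Subset.antisymm ?_ ?_⟩
      · rintro y ⟨hyQ, rfl | hyS⟩
        · rfl
        · exact (hQS y hyQ hyS).elim
      · rintro _ rfl
        exact ⟨hxQ, Set.mem_insert _ _⟩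
    · refine ⟨C w, hC w hw, Set.Subset.antisymm ?_ ?_⟩
      · rintro y ⟨hyC, rfl | hyS⟩
        · exact (h w hw hyC).elim
        · exact key w hw y hyC hyS
      · rintro _ rfl
        exact ⟨hmem _ hw, Or.inr hw⟩

/-- The weight uses `exp` because it is positive and increasing: adding a vertex and moving one
right both raise it, so a set of maximal weight admits no improvement. -/
theorem IsIrredundant.exists_minimal_isCliqueTransversal [Finite V] [Nonempty V]
    (hG : IsProperIntervalGraph G) {S₀ : Set V} (hS₀ : IsIrredundant G S₀) :
    ∃ S, Minimal (IsCliqueTransversal G) S ∧ S₀.ncard ≤ S.ncard := by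
  obtain ⟨l, hconv⟩ := hG.exists_convex_placement
  let weight : Set V → ℝ := fun S => ∑ᶠ v ∈ S, Real.exp (l v)
  have hins : ∀ (S : Set V) (x : V), x ∉ S → weight (insert x S) = Real.exp (l x) + weight S :=
    fun S x hx => finsum_mem_insert _ hx (Set.toFinite S)
  obtain ⟨S, ⟨hS, hcard⟩, hmax⟩ := Set.exists_max_image
    {S : Set V | IsIrredundant G S ∧ S₀.ncard ≤ S.ncard} weight (Set.toFinite _)
    ⟨S₀, hS₀, le_rfl⟩
  refine ⟨S, hS.minimal ?_, hcard⟩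
  by_contra hT
  obtain ⟨x, hxS, h | ⟨v, hv, hvx, h⟩⟩ := hS.exists_improvement hconv hT
  · have := hmax _ ⟨h, hcard.trans (Set.ncard_le_ncard (Set.subset_insert x S))⟩
    rw [hins S x hxS] at this
    linarith [Real.exp_pos (l x)]
  · have hxS' : x ∉ S \ {v} := fun h => hxS h.1
    have hcard' : (insert x (S \ {v})).ncard = S.ncard := by
      rw [Set.ncard_insert_of_notMem hxS', Set.ncard_sdiff_singleton_add_one hv]
    have h1 := hmax _ ⟨h, hcard'.symm ▸ hcard⟩
    have h2 := hins (S \ {v}) v (fun h => h.2 rfl)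
    rw [Set.insert_sdiff_singleton, Set.insert_eq_of_mem hv] at h2
    rw [hins _ x hxS', h2] at h1
    linarith [Real.exp_lt_exp.2 hvx]

end UpperCliqueTransversal

open UpperCliqueTransversal in
theorem mainTheorem4 {V : Type*} [Finite V] (G : SimpleGraph V)
    (hG : UpperCliqueTransversal.IsProperIntervalGraph G) :
    UpperCliqueTransversal.upperCliqueTransversalNumber G =
      UpperCliqueTransversal.inducedMatchingNumber
        (UpperCliqueTransversal.vertexCliqueIncidenceGraph G) := by
  refine le_antisymm (csSup_le' ?_) (csSup_le' ?_)
  · rintro _ ⟨S, hS, rfl⟩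
    obtain ⟨M, hM, hMS⟩ := (Minimal.isIrredundant hS).exists_isInducedMatching
    exact (isGreatest_inducedMatchingNumber _).2 ⟨M, hM, hMS⟩
  · rintro _ ⟨M, hM, rfl⟩
    obtain ⟨S₀, hS₀, hMS⟩ := hM.exists_isIrredundant
    refine hMS.trans ?_
    cases isEmpty_or_nonempty V
    -- Here `∅` is a maximal clique, so no transversal exists, but `S₀` is empty.
    · simp [Set.eq_empty_of_isEmpty S₀]
    · obtain ⟨S, hS, hle⟩ := hS₀.exists_minimal_isCliqueTransversal hG
      exact hle.trans ((isGreatest_upperCliqueTransversalNumber G).2 ⟨S, hS, rfl⟩)
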